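/- For positive integers $n$ and $q$, in the $(1:q)$ Waiter-Client game on $E(K_n)$ two players, Waiter and Client, claim the edges of $K_n$. In every round Waiter offers Client $q+1$ previously unclaimed edges; Client claims one of them and Waiter claims the other $q$. If fewer than $q+1$ unclaimed edges remain in the final round, Waiter claims all of them. The game ends when all edges of $K_n$ are claimed. Client's graph is the graph on the vertex set of $K_n$ whose edges are those claimed by Client. There is an integer $n_0$ such that for every integer $n \geq n_0$ the following holds. (i) For every real $\varepsilon \geq 4n^{-1/4}$, every non-negative integer $t \leq \varepsilon^2\sqrt{n}/5$ and every positive integer $q \leq (1-\varepsilon)n$, Waiter has a strategy in the $(1:q)$ Waiter-Client game on $E(K_n)$ which guarantees that Client's graph at the end of the game admits a $K_t$-minor. (ii) For every real $\eta \geq n^{2/3}\log n$ and every integer $q \geq n+\eta$, Client has a strategy in the $(1:q)$ Waiter-Client game on $E(K_n)$ which guarantees that his graph is $K_4$-minor free throughout the game. -/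

import Mathlib

namespace WaiterClient

/-- `H` is a minor of `G`: there are pairwise disjoint vertex sets of `G` (the branch sets), one for
each vertex of `H`, each inducing a connected (in particular nonempty) subgraph of `G`, such that `G`
has an edge between any two branch sets that belong to adjacent vertices of `H`. -/
def IsMinor {W V : Type*} (H : SimpleGraph W) (G : SimpleGraph V) : Prop :=
  ∃ B : W → Set V,
    (∀ i, (G.induce (B i)).Connected) ∧
    (∀ i j, i ≠ j → Disjoint (B i) (B j)) ∧
    (∀ i j, H.Adj i j → ∃ u ∈ B i, ∃ v ∈ B j, G.Adj u v)

section Game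

variable {X : Type*} [DecidableEq X]

/-- One round: the set of elements that Waiter offers, and the set of those among them that Client
claims. The other offered elements go to Waiter. -/
structure Round (X : Type*) where
  offered : Finset X
  claimed : Finset X

/-- The rounds played so far, the most recent one first. -/
abbrev History (X : Type*) := List (Round X)

/-- The elements offered so far; these are exactly the elements claimed by one of the players. -/
def offeredSet : History X → Finset X
  | [] => ∅
  | r :: h => r.offered ∪ offeredSet h

/-- The elements claimed by Client so far. -/
def clientSet : History X → Finset X
  | [] => ∅
  | r :: h => r.claimed ∪ clientSet h

/-- The board elements that no player has claimed yet. -/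
def freeSet (board : Finset X) (h : History X) : Finset X :=
  board \ offeredSet h

/-- Waiter offers `q + 1` free elements, or all the free elements if fewer than `q + 1` remain. -/
def LegalOffer (board : Finset X) (q : ℕ) (h : History X) (O : Finset X) : Prop :=
  O ⊆ freeSet board h ∧ O.card = min (q + 1) (freeSet board h).card

/-- Client claims `max 0 (|O| - q)` of the offered elements (the subtraction is truncated): exactly
one element if `q + 1` elements are offered, and none if fewer are offered. -/
def LegalReply (q : ℕ) (O K : Finset X) : Prop :=
  K ⊆ O ∧ K.card = O.card - q

/-- A strategy of Waiter: a legal offer after every history. (Once the board is exhausted the only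
legal offer is the empty one, so that nothing changes any more.) -/
structure WaiterStrategy (board : Finset X) (q : ℕ) where
  offer : History X → Finset X
  legal : ∀ h, LegalOffer board q h (offer h)

/-- A strategy of Client: a legal reply to every offer after every history. -/
structure ClientStrategy (X : Type*) (q : ℕ) where
  reply : History X → Finset X → Finset X
  legal : ∀ h O, LegalReply q O (reply h O)

/-- The history of the first `k` rounds when the two players follow the given strategies. -/
def play {board : Finset X} {q : ℕ} (σ : WaiterStrategy board q) (τ : ClientStrategy X q) :
    ℕ → History X
  | 0 => []
  | k + 1 =>
    let h := play σ τ k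
    ⟨σ.offer h, τ.reply h (σ.offer h)⟩ :: h

/-- In the `(1 : q)` Waiter-Client game on `board`, Waiter has a strategy which guarantees, however
Client plays, that when all elements are claimed the set of elements claimed by Client has the
property `P`. -/
def WaiterCanForce (board : Finset X) (q : ℕ) (P : Finset X → Prop) : Prop :=
  ∃ σ : WaiterStrategy board q, ∀ τ : ClientStrategy X q,
    ∃ k, freeSet board (play σ τ k) = ∅ ∧ P (clientSet (play σ τ k))

/-- In the `(1 : q)` Waiter-Client game on `board`, Client has a strategy which guarantees, however
Waiter plays, that after every round the set of elements claimed by Client has the property `P`. -/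
def ClientCanMaintain (board : Finset X) (q : ℕ) (P : Finset X → Prop) : Prop :=
  ∃ τ : ClientStrategy X q, ∀ σ : WaiterStrategy board q,
    ∀ k, P (clientSet (play σ τ k))

end Game

/-- The board `E(K_n)`. -/
def edgesK (n : ℕ) : Finset (Sym2 (Fin n)) :=
  (⊤ : SimpleGraph (Fin n)).edgeFinset

/-- The graph on the vertex set of `K_n` whose edges are the elements of `E`. -/
def graphOf {n : ℕ} (E : Finset (Sym2 (Fin n))) : SimpleGraph (Fin n) :=
  SimpleGraph.fromEdgeSet (E : Set (Sym2 (Fin n)))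

/-- The graph with edge set `E` admits a `K_t`-minor. -/
def HasCompleteMinor {n : ℕ} (t : ℕ) (E : Finset (Sym2 (Fin n))) : Prop :=
  IsMinor (⊤ : SimpleGraph (Fin t)) (graphOf E)

end WaiterClient

/-! Waiter's side. For s of order sqrt(n/ε), Waiter builds t disjoint paths on s vertices each,
always offering q + 1 edges from the current endpoint to unused vertices, so that every reply of
Client extends the path. These offers use up edges between the path and the unused vertices. Aiming
at the least damaged vertices spreads the loss evenly; since q ≤ (1 - ε)n and all paths together
have at most εn/2 vertices, every unused vertex keeps at least εs/4 free edges to each finished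
path. Hence any two paths have at least s · εs/4 ≥ q + 1 free edges between them, and one round per
pair links them (`grow_step`, `finish_blob`, `link_phase`, `exists_blob_parameters`).

Client's side. A graph with a K_4-minor is dense enough to contain a path on k + 1 vertices with two
further edges, one from each end back to the path: k + 2 edges on only k + 1 vertices
(`exists_core_of_isMinor`, `exists_path_with_chords`). There are at most n^(k+1) (k+1)^2
descriptions of such a configuration. An Erdős–Selfridge type potential lets Client avoid completing
any of them once the sum of (q+1)^(-(k+2)) over all descriptions is below 1
(`clientCanMaintain_of_sum_lt_one`). With N = q + 1 this sum is at most 2N²/(N - n)³, whence the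
exponent 2/3 in the bound on η. -/

namespace WaiterClient

/-! ### From positions to strategies for Waiter -/

section Game

variable {X : Type*} [DecidableEq X]

theorem freeSet_cons (board : Finset X) (r : Round X) (h : History X) :
    freeSet board (r :: h) = freeSet board h \ r.offered := by
  ext x
  simp only [freeSet, offeredSet, Finset.mem_sdiff, Finset.mem_union]
  tauto

/-- In a position where `S` is the set of offered elements and `C` is the set of Client's elements,
Waiter can reach a position in which Client's elements have the property `P` by offering `q + 1`
elements in every round. -/
inductive Forcible (board : Finset X) (q : ℕ) (P : Finset X → Prop) : Finset X → Finset X → Prop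
  | done (S C : Finset X) : P C → Forcible board q P S C
  | step (S C O : Finset X) : O ⊆ board \ S → O.card = q + 1 →
      (∀ e ∈ O, Forcible board q P (O ∪ S) (insert e C)) → Forcible board q P S C

theorem Forcible.done_or_step {board : Finset X} {q : ℕ} {P : Finset X → Prop} {S C : Finset X}
    (h : Forcible board q P S C) :
    P C ∨ ∃ O ⊆ board \ S, O.card = q + 1 ∧
      ∀ e ∈ O, Forcible board q P (O ∪ S) (insert e C) := by
  cases h with
  | done _ _ h => exact Or.inl h
  | step _ _ O h1 h2 h3 => exact Or.inr ⟨O, h1, h2, h3⟩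

/-- A strategy must answer every history, so an arbitrary legal offer is supplied where no winning
one exists. -/
theorem exists_legalOffer (board : Finset X) (q : ℕ) (P : Finset X → Prop) (h : History X) :
    ∃ O, LegalOffer board q h O ∧
      ((∃ O' ⊆ board \ offeredSet h, O'.card = q + 1 ∧
        ∀ e ∈ O', Forcible board q P (O' ∪ offeredSet h) (insert e (clientSet h))) →
      O.card = q + 1 ∧
        ∀ e ∈ O, Forcible board q P (O ∪ offeredSet h) (insert e (clientSet h))) := by
  by_cases hx : ∃ O' ⊆ board \ offeredSet h, O'.card = q + 1 ∧
        ∀ e ∈ O', Forcible board q P (O' ∪ offeredSet h) (insert e (clientSet h))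
  · obtain ⟨O, h1, h2, h3⟩ := hx
    refine ⟨O, ⟨h1, ?_⟩, fun _ => ⟨h2, h3⟩⟩
    have := Finset.card_le_card h1
    simp only [freeSet]
    omega
  · obtain ⟨O, h1, h2⟩ := Finset.exists_subset_card_eq
      (s := freeSet board h) (n := min (q + 1) (freeSet board h).card) (min_le_right _ _)
    exact ⟨O, ⟨h1, h2⟩, fun h => absurd h hx⟩

/-- Following winning offers keeps the position forcible, and monotonicity of `P` protects a goal
already reached. On an exhausted board another full offer is impossible, so `P` must hold. -/
theorem waiterCanForce_of_forcible {board : Finset X} {q : ℕ} {P : Finset X → Prop}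
    (hP : ∀ C C', C ⊆ C' → P C → P C') (h : Forcible board q P ∅ ∅) :
    WaiterCanForce board q P := by
  choose f hf1 hf2 using exists_legalOffer board q P
  -- Each round on a nonempty remainder uses at least one element, so `board.card` rounds exhaust
  -- the board.
  refine ⟨⟨f, hf1⟩, fun τ => ⟨board.card, ?_⟩⟩
  set σ : WaiterStrategy board q := ⟨f, hf1⟩
  have hcard : ∀ k, (freeSet board (play σ τ k)).card ≤ board.card - k := by
    intro k
    induction k with
    | zero => simp [play, freeSet, offeredSet]
    | succ k ih =>
      have hl := σ.legal (play σ τ k)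
      simp only [play, freeSet_cons]
      rw [Finset.card_sdiff_of_subset hl.1, hl.2]
      omega
  have hwin : ∀ k, Forcible board q P (offeredSet (play σ τ k)) (clientSet (play σ τ k)) := by
    intro k
    induction k with
    | zero => exact h
    | succ k ih =>
      have hl := τ.legal (play σ τ k) (σ.offer (play σ τ k))
      rcases ih.done_or_step with ih | ih
      · exact .done _ _ (hP _ _ Finset.subset_union_right ih)
      · obtain ⟨h1, h2⟩ := hf2 _ ih
        have h3 : (τ.reply (play σ τ k) (σ.offer (play σ τ k))).card = 1 := by
          rw [hl.2]
          change (f (play σ τ k)).card - q = 1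
          omega
        obtain ⟨e, he⟩ := Finset.card_eq_one.1 h3
        have h4 := h2 e (hl.1 (by simp [he]))
        simpa only [play, offeredSet, clientSet, he, Finset.insert_eq] using h4
  have hfree : freeSet board (play σ τ board.card) = ∅ := by
    have := hcard board.card
    rw [← Finset.card_eq_zero]
    omega
  refine ⟨hfree, ?_⟩
  rcases (hwin board.card).done_or_step with h1 | ⟨O, h1, h2, -⟩
  · exact h1
  · have h3 : O ⊆ ∅ := hfree ▸ h1
    have := Finset.card_le_card h3
    rw [h2, Finset.card_empty] at this
    omega

end Game

/-! ### Client's potential strategy -/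

section Potential

variable {X : Type*} [DecidableEq X]

/-- The danger of the target set `A` when `S` is the set of offered elements and `C` is the set of
Client's elements, in a game of bias `q`. -/
noncomputable def danger (q : ℕ) (S C A : Finset X) : ℝ :=
  if A ∩ S ⊆ C then ((q + 1 : ℝ)⁻¹) ^ (A \ C).card else 0

theorem danger_nonneg (q : ℕ) (S C A : Finset X) : 0 ≤ danger q S C A := by
  unfold danger
  split_ifs <;> positivity

theorem danger_union_le (q : ℕ) (O S C A : Finset X) : danger q (O ∪ S) C A ≤ danger q S C A := by
  by_cases h : A ∩ (O ∪ S) ⊆ C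
  · have h' : A ∩ S ⊆ C := (Finset.inter_subset_inter_left Finset.subset_union_right).trans h
    simp [danger, h, h']
  · rw [danger, if_neg h]
    exact danger_nonneg _ _ _ _

/-- If `A` misses the offer, no reply increases its danger. If `A` contains an offered `a`, every
reply other than `a` hands `a` to Waiter and kills `A`, while replying `a` multiplies the danger by
at most q + 1. -/
theorem sum_danger_le (q : ℕ) {O S C : Finset X} (A : Finset X) (hOS : Disjoint O S) (hCS : C ⊆ S)
    (hO : O.card = q + 1) :
    ∑ e ∈ O, danger q (O ∪ S) (insert e C) A ≤ (q + 1) * danger q S C A := by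
  have hS : ∀ e ∈ O, e ∉ S := fun e he h => Finset.disjoint_left.1 hOS he h
  by_cases h : A ∩ S ⊆ C
  swap
  · rw [danger, if_neg h, mul_zero]
    refine (Finset.sum_eq_zero fun e he => ?_).le
    rw [danger, if_neg]
    intro h'
    apply h
    intro x hx
    have hx' := Finset.mem_inter.1 hx
    rcases Finset.mem_insert.1 (h' (Finset.mem_inter.2
      ⟨hx'.1, Finset.mem_union_right _ hx'.2⟩)) with rfl | h2
    · exact absurd hx'.2 (hS _ he)
    · exact h2
  rcases (A ∩ O).eq_empty_or_nonempty with h0 | ⟨a, ha⟩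
  · have : ∀ e ∈ O, danger q (O ∪ S) (insert e C) A ≤ danger q S C A := by
      intro e he
      have heA : e ∉ A := fun h' => by
        have : e ∈ A ∩ O := Finset.mem_inter.2 ⟨h', he⟩
        simp [h0] at this
      have h1 : A \ insert e C = A \ C := by
        ext x
        simp only [Finset.mem_sdiff, Finset.mem_insert]
        constructor
        · tauto
        · rintro ⟨h1, h2⟩
          refine ⟨h1, ?_⟩
          rintro (rfl | h3)
          exacts [heA h1, h2 h3]
      unfold danger
      rw [h1, if_pos h]
      split_ifs
      · exact le_rfl
      · positivity
    calc _ ≤ ∑ e ∈ O, danger q S C A := Finset.sum_le_sum this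
      _ = _ := by simp [hO]
  · obtain ⟨haA, haO⟩ := Finset.mem_inter.1 ha
    have haC : a ∉ C := fun h' => hS a haO (hCS h')
    rw [Finset.sum_eq_single_of_mem a haO]
    · have h1 : (A \ C).card = (A \ insert a C).card + 1 := by
        rw [← Finset.card_erase_add_one (Finset.mem_sdiff.2 ⟨haA, haC⟩), ← Finset.sdiff_insert]
      rw [danger, danger, if_pos h, h1]
      split_ifs
      · rw [pow_succ]
        field_simp
        exact le_rfl
      · positivity
    · intro e he hne
      rw [danger, if_neg]
      intro h'
      rcases Finset.mem_insert.1 (h' (Finset.mem_inter.2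
        ⟨haA, Finset.mem_union_left _ haO⟩)) with h2 | h2
      exacts [hne h2.symm, haC h2]

/-- By averaging `sum_danger_le` over the q + 1 replies, the best reply does not raise the total
danger. -/
theorem exists_reply {ι : Type*} (q : ℕ) (I : Finset ι) (A : ι → Finset X) (S C O : Finset X) :
    ∃ K, LegalReply q O K ∧ (Disjoint O S → C ⊆ S → O.card ≤ q + 1 →
      ∑ i ∈ I, danger q (O ∪ S) (K ∪ C) (A i) ≤ ∑ i ∈ I, danger q S C (A i)) := by
  rcases lt_trichotomy O.card (q + 1) with hc | hc | hc
  · refine ⟨∅, ⟨by simp, ?_⟩, fun _ _ _ => ?_⟩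
    · rw [Finset.card_empty]
      omega
    · rw [Finset.empty_union]
      exact Finset.sum_le_sum fun i _ => danger_union_le _ _ _ _ _
  · have hne : O.Nonempty := Finset.card_pos.1 (by omega)
    obtain ⟨e, he, hmin⟩ := O.exists_min_image
      (fun e => ∑ i ∈ I, danger q (O ∪ S) (insert e C) (A i)) hne
    refine ⟨{e}, ⟨by simpa using he, by simp [hc]⟩, fun h1 h2 _ => ?_⟩
    have h3 : ((q : ℝ) + 1) * ∑ i ∈ I, danger q (O ∪ S) (insert e C) (A i) ≤
        (q + 1) * ∑ i ∈ I, danger q S C (A i) := by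
      calc _ = ∑ e' ∈ O, ∑ i ∈ I, danger q (O ∪ S) (insert e C) (A i) := by simp [hc]
        _ ≤ ∑ e' ∈ O, ∑ i ∈ I, danger q (O ∪ S) (insert e' C) (A i) := Finset.sum_le_sum hmin
        _ = ∑ i ∈ I, ∑ e' ∈ O, danger q (O ∪ S) (insert e' C) (A i) := Finset.sum_comm
        _ ≤ ∑ i ∈ I, (q + 1) * danger q S C (A i) :=
          Finset.sum_le_sum fun i _ => sum_danger_le q (A i) h1 h2 hc
        _ = _ := by rw [Finset.mul_sum]
    exact le_of_mul_le_mul_left h3 (by positivity)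
  · obtain ⟨K, h1, h2⟩ := Finset.exists_subset_card_eq (s := O) (n := O.card - q) (by omega)
    exact ⟨K, ⟨h1, h2⟩, fun _ _ _ => by omega⟩

/-- A set wholly claimed by Client has danger 1, but the total danger starts below 1 and never
increases. -/
theorem clientCanMaintain_of_sum_lt_one {ι : Type*} (board : Finset X) (q : ℕ) (I : Finset ι)
    (A : ι → Finset X) (hI : ∑ i ∈ I, ((q + 1 : ℝ)⁻¹) ^ (A i).card < 1) :
    ClientCanMaintain board q (fun C => ∀ i ∈ I, ¬ A i ⊆ C) := by
  choose f hf1 hf2 using fun (h : History X) (O : Finset X) =>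
    exists_reply q I A (offeredSet h) (clientSet h) O
  refine ⟨⟨f, hf1⟩, fun σ k => ?_⟩
  set τ : ClientStrategy X q := ⟨f, hf1⟩
  have key : ∀ k, clientSet (play σ τ k) ⊆ offeredSet (play σ τ k) ∧
      ∑ i ∈ I, danger q (offeredSet (play σ τ k)) (clientSet (play σ τ k)) (A i) < 1 := by
    intro k
    induction k with
    | zero => simpa [play, offeredSet, clientSet, danger] using hI
    | succ k ih =>
      obtain ⟨h1, h2⟩ := ih
      have hl := σ.legal (play σ τ k)
      refine ⟨Finset.union_subset_union (hf1 _ _).1 h1, lt_of_le_of_lt (hf2 _ _ ?_ h1 ?_) h2⟩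
      · exact (Finset.sdiff_disjoint).mono_left hl.1
      · rw [hl.2]
        exact min_le_left _ _
  intro i hi hsub
  obtain ⟨-, h2⟩ := key k
  have h3 := Finset.single_le_sum (f := fun i => danger q (offeredSet (play σ τ k))
    (clientSet (play σ τ k)) (A i)) (fun i _ => danger_nonneg _ _ _ _) hi
  have h4 : danger q (offeredSet (play σ τ k)) (clientSet (play σ τ k)) (A i) = 1 := by
    rw [danger, if_pos (Finset.inter_subset_left.trans hsub), Finset.sdiff_eq_empty_iff_subset.2 hsub]
    simp
  simp only [h4] at h3
  linarith

theorem ClientCanMaintain.mono {board : Finset X} {q : ℕ} {P Q : Finset X → Prop}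
    (h : ClientCanMaintain board q P) (hPQ : ∀ C, P C → Q C) : ClientCanMaintain board q Q := by
  obtain ⟨τ, hτ⟩ := h
  exact ⟨τ, fun σ k => hPQ _ (hτ σ k)⟩

end Potential

/-! ### Dense cores of graphs with a K_4-minor -/

section Degrees

variable {V : Type*} (G : SimpleGraph V) [DecidableRel G.Adj]

/-- The number of ordered adjacent pairs in `A × B`. -/
def adjPairs (A B : Finset V) : ℕ := ∑ v ∈ A, (B.filter (G.Adj v)).card

theorem adjPairs_pos {A B : Finset V} {v w : V} (hv : v ∈ A) (hw : w ∈ B) (h : G.Adj v w) :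
    0 < adjPairs G A B :=
  Finset.sum_pos' (fun _ _ => Nat.zero_le _)
    ⟨v, hv, Finset.card_pos.2 ⟨w, Finset.mem_filter.2 ⟨hw, h⟩⟩⟩

theorem two_mul_card_le_of_connected (B : Finset V) (h : (G.induce (B : Set V)).Connected) :
    2 * B.card ≤ adjPairs G B B + 2 := by
  classical
  have h1 := h.card_vert_le_card_edgeSet_add_one
  have h2 := (G.induce (B : Set V)).sum_degrees_eq_twice_card_edges
  rw [Nat.card_eq_fintype_card, Nat.card_eq_fintype_card, ← SimpleGraph.edgeFinset_card] at h1
  have h3 : Fintype.card (B : Set V) = B.card := by simp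
  have h4 : ∑ v : (B : Set V), (G.induce (B : Set V)).degree v = adjPairs G B B := by
    rw [adjPairs, ← Finset.sum_coe_sort B]
    refine Finset.sum_congr rfl fun v _ => ?_
    rw [← SimpleGraph.card_neighborFinset_eq_degree,
      ← Finset.card_map (Function.Embedding.subtype (· ∈ (B : Set V)))]
    congr 1
    ext w
    simp only [Finset.mem_map, SimpleGraph.mem_neighborFinset, SimpleGraph.comap_adj,
      Function.Embedding.subtype_apply, Finset.mem_filter]
    constructor
    · rintro ⟨a, ha, rfl⟩
      exact ⟨a.2, ha⟩
    · rintro ⟨hw, ha⟩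
      exact ⟨⟨w, hw⟩, ha, rfl⟩
  omega

variable [DecidableEq V]

theorem adjPairs_le_erase (W : Finset V) {v : V} (hv : v ∈ W) :
    adjPairs G W W ≤ adjPairs G (W.erase v) (W.erase v) + 2 * (W.filter (G.Adj v)).card := by
  have h1 : ∀ u, (W.filter (G.Adj u)).card =
      ((W.erase v).filter (G.Adj u)).card + if G.Adj u v then 1 else 0 := by
    intro u
    rw [Finset.filter_erase]
    split_ifs with h
    · rw [Finset.card_erase_add_one (Finset.mem_filter.2 ⟨hv, h⟩)]
    · rw [Finset.erase_eq_of_notMem (fun h' => h (Finset.mem_filter.1 h').2), add_zero]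
  have h2 : ∑ u ∈ W.erase v, (if G.Adj u v then 1 else 0) ≤ (W.filter (G.Adj v)).card := by
    rw [← Finset.card_filter]
    refine Finset.card_le_card fun u hu => ?_
    rw [Finset.mem_filter] at hu ⊢
    exact ⟨Finset.mem_of_mem_erase hu.1, hu.2.symm⟩
  have h3 : adjPairs G W W = (W.filter (G.Adj v)).card +
      ∑ u ∈ W.erase v, (W.filter (G.Adj u)).card := (Finset.add_sum_erase _ _ hv).symm
  rw [h3, Finset.sum_congr rfl (fun u _ => h1 u), Finset.sum_add_distrib]
  simp only [adjPairs]
  omega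

/-- Deleting a vertex of degree at most 1 costs at most 2 ordered pairs, so the hypothesis survives
until the minimum degree is 2; then the average degree exceeds 2. -/
theorem exists_core (W : Finset V) (hW : 2 * W.card + 2 ≤ adjPairs G W W) :
    ∃ W' : Finset V, (∀ v ∈ W', 2 ≤ (W'.filter (G.Adj v)).card) ∧
      ∃ r ∈ W', 3 ≤ (W'.filter (G.Adj r)).card := by
  induction hn : W.card generalizing W with
  | zero =>
    have : W = ∅ := Finset.card_eq_zero.1 hn
    subst this
    simp [adjPairs] at hW
  | succ n ih =>
    by_cases h : ∃ v ∈ W, (W.filter (G.Adj v)).card ≤ 1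
    · obtain ⟨v, hv, hd⟩ := h
      have h1 := adjPairs_le_erase G W hv
      have h2 := Finset.card_erase_add_one hv
      exact ih (W.erase v) (by omega) (by omega)
    · push Not at h
      refine ⟨W, h, ?_⟩
      by_contra! hr
      have : adjPairs G W W ≤ ∑ v ∈ W, 2 :=
        Finset.sum_le_sum fun v hv => Nat.le_of_lt_succ (hr v hv)
      rw [Finset.sum_const, smul_eq_mul] at this
      omega

theorem adjPairs_biUnion {ι : Type*} [DecidableEq ι] (s : Finset ι) (B : ι → Finset V)
    (hB : ∀ i j, i ≠ j → Disjoint (B i) (B j)) :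
    adjPairs G (s.biUnion B) (s.biUnion B) = ∑ i ∈ s, ∑ j ∈ s, adjPairs G (B i) (B j) := by
  rw [adjPairs, Finset.sum_biUnion (fun i _ j _ h => hB i j h)]
  refine Finset.sum_congr rfl fun i _ => ?_
  simp only [adjPairs]
  rw [Finset.sum_comm]
  refine Finset.sum_congr rfl fun v _ => ?_
  rw [Finset.filter_biUnion, Finset.card_biUnion]
  intro a _ b _ hab
  exact Finset.disjoint_filter_filter (hB a b hab)

/-- Each branch set contributes at least 2|B| - 2 inner pairs by connectedness and 3 pairs to the
other branch sets. Over four sets this exceeds twice the number of vertices by 4, more than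
`exists_core` needs. -/
theorem exists_core_of_isMinor [Fintype V] (h : IsMinor (⊤ : SimpleGraph (Fin 4)) G) :
    ∃ W : Finset V, (∀ v ∈ W, 2 ≤ (W.filter (G.Adj v)).card) ∧
      ∃ r ∈ W, 3 ≤ (W.filter (G.Adj r)).card := by
  classical
  obtain ⟨B₀, h1, h2, h3⟩ := h
  obtain ⟨B, rfl⟩ : ∃ B : Fin 4 → Finset V, B₀ = fun i => (B i : Set V) :=
    ⟨fun i => (B₀ i).toFinset, by simp⟩
  simp only [Finset.disjoint_coe, Finset.mem_coe] at h1 h2 h3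
  apply exists_core G (Finset.univ.biUnion B)
  rw [adjPairs_biUnion G _ B h2, Finset.card_biUnion (fun i _ j _ h => h2 i j h)]
  have hd : ∀ i, 2 * (B i).card ≤ adjPairs G (B i) (B i) + 2 :=
    fun i => two_mul_card_le_of_connected G (B i) (h1 i)
  have ho : ∀ i j, i ≠ j → 0 < adjPairs G (B i) (B j) := by
    intro i j hij
    obtain ⟨u, hu, v, hv, huv⟩ := h3 i j hij
    exact adjPairs_pos G hu hv huv
  have key : ∀ i, 2 * (B i).card + 1 ≤ ∑ j, adjPairs G (B i) (B j) := by
    intro i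
    have h4 : ∑ j ∈ Finset.univ.erase i, 1 ≤ ∑ j ∈ Finset.univ.erase i, adjPairs G (B i) (B j) :=
      Finset.sum_le_sum fun j hj => ho i j (Finset.ne_of_mem_erase hj).symm
    rw [← Finset.add_sum_erase _ _ (Finset.mem_univ i)]
    have h5 := hd i
    simp at h4
    omega
  calc _ ≤ ∑ i, (2 * (B i).card + 1) := by
        rw [Finset.sum_add_distrib, ← Finset.mul_sum]
        simp
    _ ≤ _ := Finset.sum_le_sum fun i _ => key i

end Degrees

/-! ### Paths with a chord at each end -/

section Paths

variable {V : Type*} [DecidableEq V]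

/-- The edges between consecutive elements of a list. -/
def pathEdges : List V → Finset (Sym2 V)
  | [] => ∅
  | [_] => ∅
  | x :: y :: l => insert s(x, y) (pathEdges (y :: l))

theorem mem_pathEdges {l : List V} {e : Sym2 V} :
    e ∈ pathEdges l ↔ ∃ x y, [x, y] <:+: l ∧ e = s(x, y) := by
  fun_induction pathEdges l with
  | case1 => simp
  | case2 a =>
    simp only [Finset.notMem_empty, false_iff]
    rintro ⟨x, y, h, -⟩
    simpa using h.length_le
  | case3 x y l ih =>
    rw [Finset.mem_insert, ih]
    constructor
    · rintro (rfl | ⟨a, b, h, rfl⟩)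
      · exact ⟨x, y, ⟨[], l, rfl⟩, rfl⟩
      · exact ⟨a, b, List.infix_cons h, rfl⟩
    · rintro ⟨a, b, h, rfl⟩
      rcases List.infix_cons_iff.1 h with h | h
      · obtain ⟨t, ht⟩ := h
        simp only [List.cons_append, List.cons.injEq, List.nil_append] at ht
        obtain ⟨rfl, rfl, -⟩ := ht
        exact Or.inl rfl
      · exact Or.inr ⟨a, b, h, rfl⟩

theorem pathEdges_reverse (l : List V) : pathEdges l.reverse = pathEdges l := by
  have : ∀ l : List V, pathEdges l ⊆ pathEdges l.reverse := by
    intro l e he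
    obtain ⟨x, y, h, rfl⟩ := mem_pathEdges.1 he
    exact mem_pathEdges.2 ⟨y, x, by simpa using List.reverse_infix.2 h, Sym2.eq_swap⟩
  refine Finset.Subset.antisymm ?_ (this l)
  simpa using this l.reverse

theorem mem_of_mem_pathEdges {l : List V} {v w : V} (h : s(v, w) ∈ pathEdges l) : v ∈ l := by
  obtain ⟨x, y, h, he⟩ := mem_pathEdges.1 h
  have hx : x ∈ l := h.subset (by simp)
  have hy : y ∈ l := h.subset (by simp)
  rcases Sym2.eq_iff.1 he with ⟨rfl, rfl⟩ | ⟨rfl, rfl⟩ <;> assumption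

theorem card_pathEdges {l : List V} (hl : l.Nodup) : (pathEdges l).card = l.length - 1 := by
  fun_induction pathEdges l with
  | case1 => simp
  | case2 a => simp
  | case3 x y l ih =>
    rw [Finset.card_insert_of_notMem, ih hl.of_cons]
    · simp
    · exact fun h => (List.nodup_cons.1 hl).1 (mem_of_mem_pathEdges h)

theorem pathEdges_cons_unique {h : V} {l : List V} (hl : (h :: l).Nodup) {z z' : V}
    (hz : s(h, z) ∈ pathEdges (h :: l)) (hz' : s(h, z') ∈ pathEdges (h :: l)) : z = z' := by
  cases l with
  | nil => simp [pathEdges] at hz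
  | cons y l =>
    have key : ∀ w, s(h, w) ∈ pathEdges (h :: y :: l) → w = y := by
      intro w hw
      rw [pathEdges, Finset.mem_insert] at hw
      rcases hw with hw | hw
      · rcases Sym2.eq_iff.1 hw with ⟨-, h1⟩ | ⟨h1, h2⟩
        · exact h1
        · exact h2.trans h1
      · exact absurd (mem_of_mem_pathEdges hw) (List.nodup_cons.1 hl).1
    rw [key z hz, key z' hz']

variable (G : SimpleGraph V) [DecidableRel G.Adj]

theorem exists_maximal_extension (W : Finset V) (a : V) (l : List V) (hn : (a :: l).Nodup)
    (hW : ∀ v ∈ a :: l, v ∈ W) (hG : ∀ e ∈ pathEdges (a :: l), e ∈ G.edgeSet) :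
    ∃ u h t, h :: t = u ++ a :: l ∧ (h :: t).Nodup ∧ (∀ v ∈ h :: t, v ∈ W) ∧
      (∀ e ∈ pathEdges (h :: t), e ∈ G.edgeSet) ∧ ∀ w ∈ W, G.Adj h w → w ∈ h :: t := by
  induction hk : W.card - l.length generalizing a l with
  | zero =>
    exfalso
    have h1 := Finset.card_le_card (s := (a :: l).toFinset) (t := W)
      (fun v hv => hW v (by simpa using hv))
    rw [List.toFinset_card_of_nodup hn, List.length_cons] at h1
    omega
  | succ k ih =>
    by_cases h : ∀ w ∈ W, G.Adj a w → w ∈ a :: l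
    · exact ⟨[], a, l, rfl, hn, hW, hG, h⟩
    · push Not at h
      obtain ⟨w, hwW, haw, hwl⟩ := h
      obtain ⟨u, h, t, h1, h2⟩ := ih w (a :: l) (List.nodup_cons.2 ⟨hwl, hn⟩)
        (by
          intro v hv
          rcases List.mem_cons.1 hv with rfl | hv
          exacts [hwW, hW v hv])
        (by
          intro e he
          rw [pathEdges, Finset.mem_insert] at he
          rcases he with rfl | he
          exacts [haw.symm, hG e he])
        (by rw [List.length_cons]; omega)
      exact ⟨u ++ [w], h, t, by simpa using h1, h2⟩

/-- Extend a path from `r` maximally, reverse it, and extend it maximally beyond `r`. Both ends then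
have all their neighbours in `W` on the path, and the degree conditions provide an off-path edge at
each. The path is started at `r` so that the two chords can be chosen distinct. -/
theorem exists_path_with_chords (W : Finset V) (hW : ∀ v ∈ W, 2 ≤ (W.filter (G.Adj v)).card)
    {r : V} (hr : r ∈ W) (hr3 : 3 ≤ (W.filter (G.Adj r)).card) :
    ∃ (l : List V) (hl : l ≠ []) (x y : V), l.Nodup ∧ x ∈ l ∧ y ∈ l ∧
      (insert s(l.head hl, x) (insert s(l.getLast hl, y) (pathEdges l))).card = l.length + 1 ∧
      ∀ e ∈ insert s(l.head hl, x) (insert s(l.getLast hl, y) (pathEdges l)), e ∈ G.edgeSet := by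
  obtain ⟨u, a, t, h1, hn1, hW1, hG1, hm1⟩ := exists_maximal_extension G W r []
    (by simp) (by simpa using hr) (by simp [pathEdges])
  have hrev : (a :: t).reverse = r :: u.reverse := by rw [h1]; simp
  obtain ⟨u', b, t', h2, hn2, hW2, hG2, hm2⟩ := exists_maximal_extension G W r u.reverse
    (by rw [← hrev]; exact List.nodup_reverse.2 hn1)
    (by rw [← hrev]; exact fun v hv => hW1 v (List.mem_reverse.1 hv))
    (by rw [← hrev, pathEdges_reverse]; exact hG1)
  rw [← hrev] at h2
  have haW : a ∈ W := hW1 a (by simp)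
  have hbW : b ∈ W := hW2 b (by simp)
  have hlast : (b :: t').getLast (by simp) = a := by
    simp only [h2]
    simp
  have hrevl : (b :: t').reverse = a :: (t ++ u'.reverse) := by rw [h2]; simp
  -- The end `a` has two neighbours in `W` but at most one path edge.
  obtain ⟨y, hyW, hay, hy⟩ : ∃ y ∈ W, G.Adj a y ∧ s(a, y) ∉ pathEdges (b :: t') := by
    by_contra! hc
    have : (W.filter (G.Adj a)).card ≤ 1 := by
      refine Finset.card_le_one.2 fun z hz z' hz' => ?_
      rw [Finset.mem_filter] at hz hz'
      have e1 := hc z hz.1 hz.2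
      have e2 := hc z' hz'.1 hz'.2
      rw [← pathEdges_reverse, hrevl] at e1 e2
      exact pathEdges_cons_unique (by rw [← hrevl]; exact List.nodup_reverse.2 hn2) e1 e2
    have := hW a haW
    omega
  have hyl : y ∈ a :: t := hm1 y hyW hay
  have hsub : ∀ v ∈ a :: t, v ∈ b :: t' := fun v hv => by
    rw [h2]
    exact List.mem_append_right _ (List.mem_reverse.2 hv)
  obtain ⟨x, hxW, hbx, hx, hxy⟩ : ∃ x ∈ W, G.Adj b x ∧ s(b, x) ∉ pathEdges (b :: t') ∧
      s(b, x) ≠ s(a, y) := by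
    by_contra! hc
    -- If `b` lies on the first path, the second extension was empty and b = r: of its three edges
    -- at most one is on the path and at most one is the chord at `a`. Otherwise `b` differs from
    -- both `a` and `y`, so no edge at `b` can equal that chord.
    by_cases hba : b ∈ a :: t
    · have hbr : b = r := by
        cases u' with
        | nil =>
          rw [hrev] at h2
          simpa using (List.cons.inj h2).1
        | cons c u' =>
          exfalso
          rw [List.cons_append] at h2
          obtain ⟨rfl, rfl⟩ := List.cons.inj h2
          exact (List.nodup_cons.1 hn2).1 (List.mem_append_right _ (List.mem_reverse.2 hba))
      subst hbr
      have h3 : ((W.filter (G.Adj b)).filter (fun z => s(b, z) ∈ pathEdges (b :: t'))).card ≤ 1 := by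
        refine Finset.card_le_one.2 fun z hz z' hz' => ?_
        exact pathEdges_cons_unique hn2 (Finset.mem_filter.1 hz).2 (Finset.mem_filter.1 hz').2
      have h4 : ((W.filter (G.Adj b)).filter (fun z => ¬ s(b, z) ∈ pathEdges (b :: t'))).card ≤ 1 := by
        refine Finset.card_le_one.2 fun z hz z' hz' => ?_
        simp only [Finset.mem_filter] at hz hz'
        have := (hc z hz.1.1 hz.1.2 hz.2).trans (hc z' hz'.1.1 hz'.1.2 hz'.2).symm
        exact Sym2.congr_right.1 this
      have := Finset.card_filter_add_card_filter_not (s := W.filter (G.Adj b))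
        (fun z => s(b, z) ∈ pathEdges (b :: t'))
      omega
    · have : (W.filter (G.Adj b)).card ≤ 1 := by
        refine Finset.card_le_one.2 fun z hz z' hz' => ?_
        rw [Finset.mem_filter] at hz hz'
        have key : ∀ z ∈ W, G.Adj b z → s(b, z) ∈ pathEdges (b :: t') := by
          intro z hz hbz
          by_contra hcon
          rcases Sym2.eq_iff.1 (hc z hz hbz hcon) with ⟨h, -⟩ | ⟨h, -⟩
          · exact hba (by simp [h])
          · exact hba (h ▸ hyl)
        exact pathEdges_cons_unique hn2 (key z hz.1 hz.2) (key z' hz'.1 hz'.2)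
      have := hW b hbW
      omega
  refine ⟨b :: t', by simp, x, y, hn2, hm2 x hxW hbx, hsub y hyl, ?_, ?_⟩
  · rw [hlast, List.head_cons, Finset.card_insert_of_notMem, Finset.card_insert_of_notMem hy,
      card_pathEdges hn2]
    · simp
    · rw [Finset.mem_insert, not_or]
      exact ⟨hxy, hx⟩
  · rw [hlast, List.head_cons]
    intro e he
    rcases Finset.mem_insert.1 he with rfl | he
    · exact hbx
    rcases Finset.mem_insert.1 he with rfl | he
    · exact hay
    · exact hG2 e he

/-- The path through the values of `f`, with a chord from its first vertex to `f a` and a chord from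
its last vertex to `f b`. -/
def chordedPath {k : ℕ} (f : Fin (k + 1) → V) (a b : Fin (k + 1)) : Finset (Sym2 V) :=
  insert s(f 0, f a) (insert s(f (Fin.last k), f b) (pathEdges (List.ofFn f)))

theorem exists_chordedPath [Fintype V] (h : IsMinor (⊤ : SimpleGraph (Fin 4)) G) :
    ∃ k < Fintype.card V, ∃ (f : Fin (k + 1) → V) (a b : Fin (k + 1)),
      (chordedPath f a b).card = k + 2 ∧ ∀ e ∈ chordedPath f a b, e ∈ G.edgeSet := by
  obtain ⟨W, hW, r, hr, hr3⟩ := exists_core_of_isMinor G h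
  obtain ⟨l, hl, x, y, hn, hx, hy, hc, hG⟩ := exists_path_with_chords G W hW hr hr3
  obtain ⟨k, hk⟩ : ∃ k, l.length = k + 1 :=
    ⟨l.length - 1, by have := List.length_pos_iff.2 hl; omega⟩
  obtain ⟨f, rfl⟩ : ∃ f : Fin (k + 1) → V, l = List.ofFn f := by
    refine ⟨fun i => l.get (i.cast hk.symm), ?_⟩
    apply List.ext_get
    · simp [hk]
    · intro i h1 h2
      rw [List.get_ofFn]
      rfl
  rw [List.mem_ofFn] at hx hy
  obtain ⟨a, rfl⟩ := hx
  obtain ⟨b, rfl⟩ := hy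
  rw [List.head_ofFn, List.getLast_ofFn] at hc hG
  refine ⟨k, ?_, f, a, b, hc.trans (by rw [List.length_ofFn]), hG⟩
  have := Fintype.card_le_of_injective f (List.nodup_ofFn.1 hn)
  simpa using this

end Paths

/-! ### Counting chorded paths -/

/-- Compare (k+1)² with (k+1)(k+2), twice a binomial coefficient, and sum the binomial series. -/
theorem sum_sq_mul_pow_le (m : ℕ) {x : ℝ} (hx : 0 ≤ x) (hx1 : x < 1) :
    ∑ k ∈ Finset.range m, ((k : ℝ) + 1) ^ 2 * x ^ k ≤ 2 / (1 - x) ^ 3 := by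
  have hs := hasSum_choose_mul_geometric_of_norm_lt_one 2 (r := x)
    (by rwa [Real.norm_of_nonneg hx])
  have h1 := sum_le_hasSum (Finset.range m) (fun i _ => by positivity) hs
  calc _ ≤ ∑ k ∈ Finset.range m, 2 * (((k + 2).choose 2 : ℕ) * x ^ k) := by
        refine Finset.sum_le_sum fun k _ => ?_
        rw [Nat.cast_choose_two, ← mul_assoc]
        refine mul_le_mul_of_nonneg_right ?_ (by positivity)
        push_cast
        nlinarith [(Nat.cast_nonneg k : (0 : ℝ) ≤ k)]
    _ ≤ 2 * (1 / (1 - x) ^ (2 + 1)) := by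
        rw [← Finset.mul_sum]
        exact mul_le_mul_of_nonneg_left h1 (by norm_num)
    _ = _ := by ring

theorem sum_chordedPath_le (n : ℕ) {r : ℝ} (hr : 0 ≤ r) (hr1 : n * r < 1) :
    ∑ i ∈ (Finset.univ : Finset (Σ k : Fin n, (Fin (k + 1) → Fin n) × Fin (k + 1) × Fin (k + 1))),
      r ^ ((i.1 : ℕ) + 2) ≤ 2 * r / (1 - n * r) ^ 3 := by
  have hx : 0 ≤ n * r := by positivity
  rw [Fintype.sum_sigma]
  calc _ = ∑ k : Fin n, r * (n * r) * ((((k : ℕ) : ℝ) + 1) ^ 2 * (n * r) ^ (k : ℕ)) := by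
        refine Finset.sum_congr rfl fun k _ => ?_
        simp
        ring
    _ = r * (n * r) * ∑ k ∈ Finset.range n, ((k : ℝ) + 1) ^ 2 * (n * r) ^ k := by
        rw [← Finset.mul_sum,
          Fin.sum_univ_eq_sum_range (fun k : ℕ => ((k : ℝ) + 1) ^ 2 * (n * r) ^ k)]
    _ ≤ r * 1 * (2 / (1 - n * r) ^ 3) := by
        have h1 := sum_sq_mul_pow_le n hx hr1
        have h2 : 0 ≤ ∑ k ∈ Finset.range n, ((k : ℝ) + 1) ^ 2 * (n * r) ^ k :=
          Finset.sum_nonneg fun _ _ => by positivity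
        exact mul_le_mul (mul_le_mul_of_nonneg_left hr1.le hr) h1 h2 (by positivity)
    _ = _ := by ring

/-- For n ≥ 27, log n ≥ 3 and n^(2/3) ≥ 9. Thus z ≥ 3n^(2/3) and z ≥ 27, so z³ is at least 27n² and
at least 27z², which beats 2(n + z)² ≤ 4n² + 4z². -/
theorem two_mul_sq_lt_cube {n z : ℝ} (hn : 27 ≤ n) (hz : n ^ (2 / 3 : ℝ) * Real.log n ≤ z) :
    2 * (n + z) ^ 2 < z ^ 3 := by
  have hlog : 3 ≤ Real.log n := by
    have h1 : Real.log 27 ≤ Real.log n := Real.log_le_log (by norm_num) hn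
    have h2 : Real.log 27 = 3 * Real.log 3 := by
      rw [show (27 : ℝ) = 3 ^ 3 by norm_num, Real.log_pow]
      norm_num
    have h3 : 1 ≤ Real.log 3 := by
      rw [Real.le_log_iff_exp_le (by norm_num)]
      linarith [Real.exp_one_lt_d9]
    linarith
  have hp : (9 : ℝ) ≤ n ^ (2 / 3 : ℝ) := by
    calc (9 : ℝ) = (27 : ℝ) ^ (2 / 3 : ℝ) := by
          rw [show (27 : ℝ) = 3 ^ (3 : ℝ) by norm_num, ← Real.rpow_mul (by norm_num)]
          norm_num
      _ ≤ _ := Real.rpow_le_rpow (by norm_num) hn (by norm_num)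
  have hp3 : (n ^ (2 / 3 : ℝ)) ^ 3 = n ^ 2 := by
    rw [← Real.rpow_natCast, ← Real.rpow_mul (by linarith), ← Real.rpow_natCast]
    norm_num
  set p := n ^ (2 / 3 : ℝ)
  have hz1 : p * 3 ≤ z := by nlinarith
  have hz2 : 27 * n ^ 2 ≤ z ^ 3 := by
    have := pow_le_pow_left₀ (by positivity) hz1 3
    rw [mul_pow, hp3] at this
    linarith
  have hz3 : 27 * z ^ 2 ≤ z ^ 3 := by nlinarith [sq_nonneg z]
  nlinarith [sq_nonneg (n - z)]

theorem client_maintains_no_K4_minor {n q : ℕ} {η : ℝ} (hn : 27 ≤ n)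
    (hη : (n : ℝ) ^ (2 / 3 : ℝ) * Real.log (n : ℝ) ≤ η) (hq : (n : ℝ) + η ≤ (q : ℝ)) :
    ClientCanMaintain (edgesK n) q (fun E => ¬ HasCompleteMinor 4 E) := by
  have hn' : (27 : ℝ) ≤ n := by exact_mod_cast hn
  set N : ℝ := (q : ℝ) + 1
  have hc := two_mul_sq_lt_cube hn' (z := N - n) (by simp only [N]; linarith)
  have hNn : 0 < N - n := by
    by_contra! h
    have h1 : (N - n) ^ 3 ≤ 0 := Odd.pow_nonpos (by decide) h
    nlinarith [sq_nonneg (n + (N - n))]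
  have hN : 0 < N := by linarith
  -- Degenerate descriptions with coinciding edges would weigh too much; the filter drops them.
  refine (clientCanMaintain_of_sum_lt_one (edgesK n) q
    ((Finset.univ : Finset (Σ k : Fin n, (Fin (k + 1) → Fin n) × Fin (k + 1) × Fin (k + 1))).filter
      fun i => (chordedPath i.2.1 i.2.2.1 i.2.2.2).card = i.1 + 2)
    (fun i => chordedPath i.2.1 i.2.2.1 i.2.2.2) ?_).mono ?_
  · have hx : n * N⁻¹ < 1 := by rw [← div_eq_mul_inv, div_lt_one hN]; linarith
    calc _ = ∑ i ∈ (Finset.univ : Finset (Σ k : Fin n,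
            (Fin (k + 1) → Fin n) × Fin (k + 1) × Fin (k + 1))).filter
            (fun i => (chordedPath i.2.1 i.2.2.1 i.2.2.2).card = i.1 + 2),
            N⁻¹ ^ ((i.1 : ℕ) + 2) := by
          refine Finset.sum_congr rfl fun i hi => ?_
          rw [(Finset.mem_filter.1 hi).2]
      _ ≤ _ := Finset.sum_le_sum_of_subset_of_nonneg (Finset.filter_subset _ _)
          fun _ _ _ => by positivity
      _ ≤ _ := sum_chordedPath_le n (by positivity) hx
      _ < 1 := by
          have h1 : 1 - n * N⁻¹ = (N - n) / N := by field_simp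
          rw [h1, div_pow, div_div_eq_mul_div, div_lt_one (by positivity)]
          calc 2 * N⁻¹ * N ^ 3 = 2 * (n + (N - n)) ^ 2 := by
                field_simp
                ring
            _ < _ := hc
  · intro E hE hminor
    classical
    obtain ⟨k, hk, f, a, b, hcard, hG⟩ := exists_chordedPath (graphOf E) hminor
    rw [Fintype.card_fin] at hk
    refine hE ⟨⟨k, hk⟩, f, a, b⟩ (by simpa using hcard) fun e he => ?_
    have h1 := hG e he
    rw [graphOf, SimpleGraph.edgeSet_fromEdgeSet] at h1
    exact h1.1

/-! ### Waiter builds the branch sets -/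

section Blobs

variable {n : ℕ}

theorem filter_subset_filter_of_imp {α : Type*} {s : Finset α} {p q : α → Prop} [DecidablePred p]
    [DecidablePred q] (h : ∀ x ∈ s, p x → q x) : s.filter p ⊆ s.filter q := fun x hx =>
  Finset.mem_filter.2 ⟨(Finset.mem_filter.1 hx).1,
    h x (Finset.mem_filter.1 hx).1 (Finset.mem_filter.1 hx).2⟩

theorem graphOf_mono {C C' : Finset (Sym2 (Fin n))} (h : C ⊆ C') : graphOf C ≤ graphOf C' :=
  SimpleGraph.fromEdgeSet_mono (by exact_mod_cast h)

theorem induce_connected_mono {C C' : Finset (Sym2 (Fin n))} (h : C ⊆ C') {s : Set (Fin n)}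
    (hc : ((graphOf C).induce s).Connected) : ((graphOf C').induce s).Connected :=
  hc.mono (SimpleGraph.comap_monotone _ (graphOf_mono h))

theorem HasCompleteMinor.mono {t : ℕ} {C C' : Finset (Sym2 (Fin n))} (h : C ⊆ C')
    (hc : HasCompleteMinor t C) : HasCompleteMinor t C' := by
  obtain ⟨B, h1, h2, h3⟩ := hc
  refine ⟨B, fun i => induce_connected_mono h (h1 i), h2, fun i j hij => ?_⟩
  obtain ⟨u, hu, v, hv, huv⟩ := h3 i j hij
  exact ⟨u, hu, v, hv, graphOf_mono h huv⟩

theorem mem_edgesK {u v : Fin n} : s(u, v) ∈ edgesK n ↔ u ≠ v := by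
  simp [edgesK]

theorem adj_graphOf_insert {u v : Fin n} (h : u ≠ v) (C : Finset (Sym2 (Fin n))) :
    (graphOf (insert s(u, v) C)).Adj u v := by
  simp [graphOf, h]

/-- The number of elements of `b` whose edge to `u` has been offered. -/
def damage (S : Finset (Sym2 (Fin n))) (b : Finset (Fin n)) (u : Fin n) : ℕ :=
  (b.filter fun w => s(w, u) ∈ S).card

/-- The first `i` branch sets are the connected sets `B 0, …, B (i - 1)` of size `s`, outside the set
`W` of unused vertices, with many free edges between each other and to every vertex of `W`. -/
structure Built (s m i : ℕ) (B : ℕ → Finset (Fin n)) (W : Finset (Fin n))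
    (S C : Finset (Sym2 (Fin n))) : Prop where
  conn : ∀ j < i, ((graphOf C).induce (B j : Set (Fin n))).Connected
  card : ∀ j < i, (B j).card = s
  disjW : ∀ j < i, Disjoint (B j) W
  disj : ∀ j < i, ∀ k < i, j ≠ k → Disjoint (B j) (B k)
  free : ∀ j < i, ∀ u ∈ W, m ≤ ((B j).filter fun w => s(w, u) ∉ S).card
  pair : ∀ j k, j < k → k < i →
    s * m ≤ ((B j ×ˢ B k).filter fun p => s(p.1, p.2) ∉ S).card

/-- The next branch set, to be chosen in `W`, consists at present of the vertices of a path with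
vertex set `b` and last vertex `v`. -/
structure Growing (q : ℕ) (W b : Finset (Fin n)) (v : Fin n) (S C : Finset (Sym2 (Fin n))) :
    Prop where
  subset : b ⊆ W
  mem : v ∈ b
  conn : ((graphOf C).induce (b : Set (Fin n))).Connected
  fresh : ∀ u ∈ W \ b, ∀ w ∈ insert v (W \ b), s(w, u) ∉ S
  balanced : ∀ u ∈ W \ b, ∀ w ∈ W \ b, damage S b u ≤ damage S b w + 1
  sum_le : ∑ u ∈ W \ b, damage S b u + (q + 1) ≤ b.card * (q + 1)

variable {s m i q : ℕ} {B : ℕ → Finset (Fin n)} {W b : Finset (Fin n)} {v : Fin n}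
  {S C : Finset (Sym2 (Fin n))}

/-- While a new path grows, all offered edges lie inside `W`; every edge counted by `Built` has an
end in an old branch set, hence outside `W`. -/
theorem Built.mono (h : Built s m i B W S C) {S' C' : Finset (Sym2 (Fin n))} (hC : C ⊆ C')
    (hS : ∀ a c, a ∉ W → s(a, c) ∈ S' → s(a, c) ∈ S) : Built s m i B W S' C' where
  conn j hj := induce_connected_mono hC (h.conn j hj)
  card := h.card
  disjW := h.disjW
  disj := h.disj
  free j hj u hu := (h.free j hj u hu).trans <| Finset.card_le_card <|
    filter_subset_filter_of_imp fun w hw hwS hw' =>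
      hwS (hS w u (Finset.disjoint_left.1 (h.disjW j hj) hw) hw')
  pair j k hjk hk := (h.pair j k hjk hk).trans <| Finset.card_le_card <|
    filter_subset_filter_of_imp fun p hp hpS hp' =>
      hpS (hS p.1 p.2 (Finset.disjoint_left.1 (h.disjW j (hjk.trans hk))
        (Finset.mem_product.1 hp).1) hp')

theorem exists_least_subset {α : Type*} [DecidableEq α] (U : Finset α) (d : α → ℕ) {k : ℕ}
    (hk : k ≤ U.card) :
    ∃ T ⊆ U, T.card = k ∧ ∀ a ∈ T, ∀ c ∈ U, c ∉ T → d a ≤ d c := by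
  induction k with
  | zero => exact ⟨∅, by simp, by simp, by simp⟩
  | succ k ih =>
    obtain ⟨T, h1, h2, h3⟩ := ih (by omega)
    have hne : (U \ T).Nonempty := by
      rw [← Finset.card_pos, Finset.card_sdiff_of_subset h1]
      omega
    obtain ⟨x, hx, hmin⟩ := (U \ T).exists_min_image d hne
    obtain ⟨hxU, hxT⟩ := Finset.mem_sdiff.1 hx
    refine ⟨insert x T, Finset.insert_subset hxU h1, by
      rw [Finset.card_insert_of_notMem hxT, h2], fun a ha c hc hcT => ?_⟩
    rw [Finset.mem_insert, not_or] at hcT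
    rcases Finset.mem_insert.1 ha with rfl | ha
    · exact hmin c (Finset.mem_sdiff.2 ⟨hc, hcT.2⟩)
    · exact h3 a ha c hc hcT.2

/-- The new endpoint `u` adds no damage, as none of its edges to the remaining vertices has been
offered; only the edge from `v` changes status, and only for targets in `T`. -/
theorem damage_step (h : Growing q W b v S C) {T : Finset (Fin n)} (hT : T ⊆ W \ b) {u x : Fin n}
    (hu : u ∈ W \ b) (hx : x ∈ W \ b) :
    damage (T.image (fun y => s(v, y)) ∪ S) (insert u b) x =
      damage S b x + if x ∈ T then 1 else 0 := by
  have hvT : ∀ y ∈ T, y ∉ b := fun y hy => (Finset.mem_sdiff.1 (hT hy)).2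
  have hub := (Finset.mem_sdiff.1 hu).2
  have hxb := (Finset.mem_sdiff.1 hx).2
  have h1 : ∀ w, s(w, x) ∈ T.image (fun y => s(v, y)) ↔ w = v ∧ x ∈ T := by
    intro w
    rw [Finset.mem_image]
    constructor
    · rintro ⟨y, hy, he⟩
      rcases Sym2.eq_iff.1 he with ⟨rfl, rfl⟩ | ⟨rfl, -⟩
      · exact ⟨rfl, hy⟩
      · exact absurd h.mem hxb
    · rintro ⟨rfl, hx⟩
      exact ⟨x, hx, rfl⟩
  have hux : s(u, x) ∉ S := h.fresh x hx u (Finset.mem_insert_of_mem hu)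
  have hvx : s(v, x) ∉ S := h.fresh x hx v (Finset.mem_insert_self _ _)
  have huv : u ≠ v := fun e => hub (e ▸ h.mem)
  unfold damage
  rw [Finset.filter_insert, if_neg (by rw [Finset.mem_union, h1]; tauto)]
  split_ifs with hxT
  · rw [← Finset.card_insert_of_notMem (a := v) (by simp [hvx])]
    congr 1
    ext w
    simp only [Finset.mem_filter, Finset.mem_union, h1, Finset.mem_insert]
    have := h.mem
    constructor
    · tauto
    · rintro (rfl | h)
      · exact ⟨this, Or.inl ⟨rfl, hxT⟩⟩
      · tauto
  · congr 1
    ext w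
    simp only [Finset.mem_filter, Finset.mem_union, h1]
    tauto

/-- Offer the edges from `v` to the q + 1 least damaged vertices. Raising the smallest damages by
one keeps all of them within one of each other. -/
theorem grow_step (hB : Built s m i B W S C) (hG : Growing q W b v S C)
    (hc : q + 1 ≤ (W \ b).card) :
    ∃ O ⊆ edgesK n \ S, O.card = q + 1 ∧ ∀ e ∈ O, ∃ u ∈ W \ b,
      Built s m i B W (O ∪ S) (insert e C) ∧
      Growing q W (insert u b) u (O ∪ S) (insert e C) := by
  obtain ⟨T, hT, hTc, hTm⟩ := exists_least_subset (W \ b) (damage S b) hc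
  have hvT : ∀ y ∈ T, v ≠ y := by
    rintro y hy rfl
    exact (Finset.mem_sdiff.1 (hT hy)).2 hG.mem
  refine ⟨T.image (fun y => s(v, y)), ?_, ?_, ?_⟩
  · intro e he
    obtain ⟨y, hy, rfl⟩ := Finset.mem_image.1 he
    exact Finset.mem_sdiff.2 ⟨mem_edgesK.2 (hvT y hy),
      hG.fresh y (hT hy) v (Finset.mem_insert_self _ _)⟩
  · rw [Finset.card_image_of_injective _ (fun x y h => Sym2.congr_right.1 h), hTc]
  intro e he
  obtain ⟨u, hu, rfl⟩ := Finset.mem_image.1 he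
  have hu' := hT hu
  obtain ⟨huW, hub⟩ := Finset.mem_sdiff.1 hu'
  have hsub : W \ insert u b ⊆ W \ b :=
    Finset.sdiff_subset_sdiff le_rfl (Finset.subset_insert _ _)
  refine ⟨u, hu', hB.mono (Finset.subset_insert _ _) ?_,
    ⟨Finset.insert_subset huW hG.subset, Finset.mem_insert_self _ _, ?_, ?_, ?_, ?_⟩⟩
  · intro a c ha hac
    rcases Finset.mem_union.1 hac with hac | hac
    · exfalso
      obtain ⟨y, hy, he⟩ := Finset.mem_image.1 hac
      rcases Sym2.eq_iff.1 he with ⟨rfl, -⟩ | ⟨-, rfl⟩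
      · exact ha (hG.subset hG.mem)
      · exact ha (Finset.mem_sdiff.1 (hT hy)).1
    · exact hac
  · have h1 : ((insert u b : Finset (Fin n)) : Set (Fin n)) = (b : Set (Fin n)) ∪ {u} := by
      rw [Finset.coe_insert, Set.insert_eq, Set.union_comm]
    rw [h1]
    exact SimpleGraph.connected_induce_union
      (induce_connected_mono (Finset.subset_insert _ _) hG.conn).preconnected
      SimpleGraph.Preconnected.of_subsingleton
      (Finset.mem_coe.2 hG.mem) (Set.mem_singleton u) (adj_graphOf_insert (hvT u hu) C)
  · intro x hx w hw hxw
    have hx' := hsub hx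
    have hw' : w ∈ W \ b := by
      rcases Finset.mem_insert.1 hw with rfl | hw
      exacts [hu', hsub hw]
    rcases Finset.mem_union.1 hxw with h | h
    · obtain ⟨y, hy, he⟩ := Finset.mem_image.1 h
      rcases Sym2.eq_iff.1 he with ⟨rfl, -⟩ | ⟨rfl, -⟩
      · exact (Finset.mem_sdiff.1 hw').2 hG.mem
      · exact (Finset.mem_sdiff.1 hx').2 hG.mem
    · exact hG.fresh x hx' w (Finset.mem_insert_of_mem hw') h
  · intro x hx w hw
    rw [damage_step hG hT hu' (hsub hx), damage_step hG hT hu' (hsub hw)]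
    have h1 := hG.balanced x (hsub hx) w (hsub hw)
    by_cases h2 : x ∈ T
    · by_cases h3 : w ∈ T
      · simp [h2, h3, h1]
      · have := hTm x h2 w (hsub hw) h3
        simp [h2, h3, this]
    · by_cases h3 : w ∈ T <;> simp [h2, h3] <;> omega
  · rw [Finset.sum_congr rfl fun x hx => damage_step hG hT hu' (hsub hx),
      Finset.card_insert_of_notMem hub]
    have h1 : ∑ x ∈ W \ insert u b, (damage S b x + if x ∈ T then 1 else 0) ≤
        ∑ x ∈ W \ b, (damage S b x + if x ∈ T then 1 else 0) :=
      Finset.sum_le_sum_of_subset hsub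
    have h4 : ∑ x ∈ W \ b, (if x ∈ T then 1 else 0) = q + 1 := by
      rw [Finset.sum_ite_mem, Finset.inter_eq_right.2 hT, Finset.sum_const, hTc, smul_eq_mul, mul_one]
    rw [Finset.sum_add_distrib (s := W \ b), h4] at h1
    have h2 := hG.sum_le
    have h3 : (b.card + 1) * (q + 1) = b.card * (q + 1) + (q + 1) := by ring
    omega

theorem grow_phase {P : Finset (Sym2 (Fin n)) → Prop} (hW : s + q ≤ W.card)
    (hfin : ∀ S C b v, Built s m i B W S C → Growing q W b v S C → b.card = s →
      Forcible (edgesK n) q P S C)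
    (hB : Built s m i B W S C) (hG : Growing q W b v S C) (hb : b.card ≤ s) :
    Forcible (edgesK n) q P S C := by
  induction hr : s - b.card generalizing S C b v with
  | zero => exact hfin S C b v hB hG (by omega)
  | succ r ih =>
    have hcard := Finset.card_sdiff_of_subset hG.subset
    obtain ⟨O, h1, h2, h3⟩ := grow_step hB hG (by omega)
    refine .step S C O h1 h2 fun e he => ?_
    obtain ⟨u, hu, hB', hG'⟩ := h3 e he
    have := Finset.card_insert_of_notMem (Finset.mem_sdiff.1 hu).2
    exact ih hB' hG' (by omega) (by omega)

/-- Damage above `D` at one vertex would, by balance, mean at least `D` at all of them, exceeding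
the total (s - 1)(q + 1) from the s - 1 rounds that built the path. -/
theorem damage_le (hG : Growing q W b v S C) (hb : b.card = s) {D : ℕ}
    (hD : (s - 1) * (q + 1) < D * (W \ b).card) {u : Fin n} (hu : u ∈ W \ b) :
    damage S b u ≤ D := by
  by_contra! h
  have h1 : ∑ w ∈ W \ b, D ≤ ∑ w ∈ W \ b, damage S b w :=
    Finset.sum_le_sum fun w hw => by
      have := hG.balanced u hu w hw
      omega
  rw [Finset.sum_const, smul_eq_mul] at h1
  have h2 := hG.sum_le
  rw [hb] at h2
  have h3 : (s - 1) * (q + 1) + (q + 1) = s * (q + 1) := by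
    have : 0 < s := hb ▸ Finset.card_pos.2 ⟨v, hG.mem⟩
    rw [← Nat.succ_mul]
    congr 1
    omega
  rw [mul_comm D] at hD
  omega

/-- Damage at most `D` leaves each remaining vertex s - D ≥ m free edges to the new set. Each of the
`s` vertices of the new set had `m` free edges to every older one, which gives s · m per pair. -/
theorem finish_blob (hB : Built s m i B W S C) (hG : Growing q W b v S C) (hb : b.card = s) {D : ℕ}
    (hs : m + D ≤ s) (hD : (s - 1) * (q + 1) < D * (W \ b).card) :
    Built s m (i + 1) (Function.update B i b) (W \ b) S C := by
  have hold : ∀ j < i, Function.update B i b j = B j := fun j hj =>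
    Function.update_of_ne hj.ne _ _
  have hnew : Function.update B i b i = b := Function.update_self _ _ _
  have hcase : ∀ j < i + 1, j < i ∨ j = i := fun j hj => by omega
  have hdisj : ∀ j < i, Disjoint (B j) b := fun j hj => (hB.disjW j hj).mono_right hG.subset
  constructor
  · intro j hj
    rcases hcase j hj with h | rfl
    · rw [hold j h]; exact hB.conn j h
    · rw [hnew]; exact hG.conn
  · intro j hj
    rcases hcase j hj with h | rfl
    · rw [hold j h]; exact hB.card j h
    · rw [hnew]; exact hb
  · intro j hj
    rcases hcase j hj with h | rfl
    · rw [hold j h]; exact (hB.disjW j h).mono_right Finset.sdiff_subset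
    · rw [hnew]; exact Finset.disjoint_sdiff
  · intro j hj k hk hjk
    rcases hcase j hj with h | rfl <;> rcases hcase k hk with h' | rfl
    · rw [hold j h, hold k h']; exact hB.disj j h k h' hjk
    · rw [hold j h, hnew]; exact hdisj j h
    · rw [hold k h', hnew]; exact (hdisj k h').symm
    · exact absurd rfl hjk
  · intro j hj u hu
    rcases hcase j hj with h | rfl
    · rw [hold j h]; exact hB.free j h u (Finset.mem_sdiff.1 hu).1
    · rw [hnew]
      have h1 := damage_le hG hb hD hu
      have h2 := Finset.card_filter_add_card_filter_not (s := b) (fun w => s(w, u) ∈ S)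
      simp only [damage] at h1
      omega
  · intro j k hjk hk
    rcases hcase k hk with h | rfl
    · rw [hold j (hjk.trans h), hold k h]; exact hB.pair j k hjk h
    · rw [hold j hjk, hnew, Finset.card_filter, Finset.sum_product_right]
      simp only [← Finset.card_filter]
      rw [← hb, ← smul_eq_mul]
      exact Finset.card_nsmul_le_sum _ _ _ fun u hu => hB.free j hjk u (hG.subset hu)

theorem Growing.singleton (hv : v ∈ W) (hS : ∀ u ∈ W, ∀ w ∈ W, s(w, u) ∉ S) :
    Growing q W {v} v S C := by
  have hd : ∀ u ∈ W \ {v}, damage S {v} u = 0 := by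
    intro u hu
    simp [damage, Finset.filter_singleton, hS u (Finset.mem_sdiff.1 hu).1 v hv]
  refine ⟨by simpa using hv, by simp, ?_, ?_, ?_, ?_⟩
  · rw [Finset.coe_singleton]
    exact { preconnected := SimpleGraph.Preconnected.of_subsingleton, nonempty := ⟨⟨v, rfl⟩⟩ }
  · intro u hu w hw
    refine hS u (Finset.mem_sdiff.1 hu).1 w ?_
    rcases Finset.mem_insert.1 hw with rfl | hw
    exacts [hv, (Finset.mem_sdiff.1 hw).1]
  · intro u hu w hw
    rw [hd u hu]
    exact Nat.zero_le _
  · rw [Finset.sum_eq_zero hd]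
    simp

theorem blob_phase {P : Finset (Sym2 (Fin n)) → Prop} {t D : ℕ} (hs0 : 0 < s) (hs : m + D ≤ s)
    (hq : q + 1 + t * s ≤ n) (hD : (s - 1) * (q + 1) < D * (n - t * s))
    (hfin : ∀ S C B W, Built s m t B W S C → Forcible (edgesK n) q P S C)
    (hit : i ≤ t) (hB : Built s m i B W S C) (hS : ∀ u ∈ W, ∀ w ∈ W, s(w, u) ∉ S)
    (hW : W.card + i * s = n) : Forcible (edgesK n) q P S C := by
  induction hr : t - i generalizing i B W S C with
  | zero =>
    obtain rfl : i = t := by omega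
    exact hfin S C B W hB
  | succ r ih =>
    have h1 : (i + 1) * s ≤ t * s := Nat.mul_le_mul_right s (by omega)
    have h2 : (i + 1) * s = i * s + s := Nat.succ_mul i s
    obtain ⟨v, hv⟩ : W.Nonempty := Finset.card_pos.1 (by omega)
    refine grow_phase (by omega) (fun S C b v hB hG hb => ?_) hB (.singleton hv hS)
      (by rwa [Finset.card_singleton])
    have hcard := Finset.card_sdiff_of_subset hG.subset
    refine ih (by omega) (finish_blob hB hG hb hs (hD.trans_le (Nat.mul_le_mul_left D (by omega))))
      (fun u hu w hw => hG.fresh u hu w (Finset.mem_insert_of_mem hw)) (by omega) (by omega)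

/-! ### Waiter links the branch sets -/

theorem link_step {A A' : Finset (Fin n)} (hA : Disjoint A A')
    (hf : q + 1 ≤ ((A ×ˢ A').filter fun p => s(p.1, p.2) ∉ S).card) :
    ∃ O ⊆ edgesK n \ S, O.card = q + 1 ∧
      (∀ e ∈ O, ∃ u ∈ A, ∃ v ∈ A', e = s(u, v) ∧ u ≠ v) := by
  obtain ⟨T, hT, hTc⟩ := Finset.exists_subset_card_eq hf
  have hT' : ∀ p ∈ T, p.1 ∈ A ∧ p.2 ∈ A' ∧ s(p.1, p.2) ∉ S := fun p hp => by
    have := hT hp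
    simpa [and_assoc] using this
  have hne : ∀ p ∈ T, ∀ p' ∈ T, p.1 ≠ p'.2 := fun p hp p' hp' h =>
    Finset.disjoint_left.1 hA (hT' p hp).1 (h ▸ (hT' p' hp').2.1)
  refine ⟨T.image (fun p => s(p.1, p.2)), ?_, ?_, ?_⟩
  · intro e he
    obtain ⟨p, hp, rfl⟩ := Finset.mem_image.1 he
    exact Finset.mem_sdiff.2 ⟨mem_edgesK.2 (hne p hp p hp), (hT' p hp).2.2⟩
  · rw [Finset.card_image_of_injOn, hTc]
    intro p hp p' hp' h
    rcases Sym2.eq_iff.1 h with ⟨h1, h2⟩ | ⟨h1, -⟩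
    · exact Prod.ext h1 h2
    · exact absurd h1 (hne p hp p' hp')
  · intro e he
    obtain ⟨p, hp, rfl⟩ := Finset.mem_image.1 he
    exact ⟨p.1, (hT' p hp).1, p.2, (hT' p hp).2.1, rfl, hne p hp p hp⟩

/-- Any reply to q + 1 free edges between two branch sets links them. The branch sets being
disjoint, such an offer uses up no edge reserved for another pair. -/
theorem link_phase {t : ℕ} (B : Fin t → Finset (Fin n))
    (hdisj : ∀ i j, i ≠ j → Disjoint (B i) (B j)) (todo : Finset (Fin t × Fin t))
    (hlt : ∀ p ∈ todo, p.1 < p.2)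
    (hconn : ∀ i, ((graphOf C).induce (B i : Set (Fin n))).Connected)
    (hfree : ∀ p ∈ todo, q + 1 ≤ ((B p.1 ×ˢ B p.2).filter fun x => s(x.1, x.2) ∉ S).card)
    (hdone : ∀ i j, i < j → (i, j) ∉ todo → ∃ u ∈ B i, ∃ v ∈ B j, (graphOf C).Adj u v) :
    Forcible (edgesK n) q (HasCompleteMinor t) S C := by
  induction todo using Finset.induction_on generalizing S C with
  | empty =>
    refine .done _ _ ⟨fun i => (B i : Set (Fin n)), hconn, ?_, ?_⟩
    · intro i j hij
      exact Finset.disjoint_coe.2 (hdisj i j hij)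
    · intro i j hij
      rcases lt_or_gt_of_ne ((SimpleGraph.top_adj _ _).1 hij) with h | h
      · exact hdone i j h (by simp)
      · obtain ⟨u, hu, v, hv, huv⟩ := hdone j i h (by simp)
        exact ⟨v, hv, u, hu, huv.symm⟩
  | insert p todo hp ih =>
    have hp12 := hlt p (Finset.mem_insert_self _ _)
    obtain ⟨O, hO1, hO2, hO3⟩ := link_step (hdisj p.1 p.2 hp12.ne)
      (hfree p (Finset.mem_insert_self _ _))
    have hblob : ∀ {i j x}, x ∈ B i → x ∈ B j → i = j := fun {i j x} h1 h2 => by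
      by_contra h
      exact Finset.disjoint_left.1 (hdisj i j h) h1 h2
    refine .step S C O hO1 hO2 fun e he => ih (fun p hp => hlt p (Finset.mem_insert_of_mem hp))
      (fun i => induce_connected_mono (Finset.subset_insert _ _) (hconn i)) ?_ ?_
    · intro p' hp'
      refine (hfree p' (Finset.mem_insert_of_mem hp')).trans (Finset.card_le_card ?_)
      refine filter_subset_filter_of_imp fun x hx hxS hx' => ?_
      rcases Finset.mem_union.1 hx' with h | h
      · obtain ⟨u, hu, w, hw, h1, -⟩ := hO3 _ h
        obtain ⟨hx1, hx2⟩ := Finset.mem_product.1 hx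
        have hlt' := hlt p' (Finset.mem_insert_of_mem hp')
        -- An offered edge reappearing for `p'` forces p' = p or its reversal, and the ordering of
        -- the coordinates excludes the latter.
        rcases Sym2.eq_iff.1 h1 with ⟨rfl, rfl⟩ | ⟨rfl, rfl⟩
        · have : p' = p := Prod.ext (hblob hx1 hu) (hblob hx2 hw)
          exact hp (this ▸ hp')
        · have e1 := hblob hx1 hw
          have e2 := hblob hx2 hu
          rw [e1, e2] at hlt'
          exact lt_asymm hlt' hp12
      · exact hxS h
    · intro i j hij hnot
      by_cases h : (i, j) = p
      · subst h
        obtain ⟨u, hu, w, hw, rfl, hne⟩ := hO3 e he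
        exact ⟨u, hu, w, hw, adj_graphOf_insert hne C⟩
      · obtain ⟨u, hu, w, hw, huw⟩ := hdone i j hij (by simp [h, hnot])
        exact ⟨u, hu, w, hw, graphOf_mono (Finset.subset_insert _ _) huw⟩

theorem waiterCanForce_minor {t D : ℕ} (hs0 : 0 < s) (hs : m + D ≤ s)
    (hq : q + 1 + t * s ≤ n) (hD : (s - 1) * (q + 1) < D * (n - t * s)) (hm : q + 1 ≤ s * m) :
    WaiterCanForce (edgesK n) q (HasCompleteMinor t) := by
  refine waiterCanForce_of_forcible (fun C C' h => HasCompleteMinor.mono h) ?_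
  refine blob_phase (i := 0) (B := fun _ => ∅) (W := Finset.univ) hs0 hs hq hD ?_ (Nat.zero_le _)
    ⟨by simp, by simp, by simp, by simp, by simp, by simp⟩ (by simp) (by simp)
  intro S C B W hB
  refine link_phase (fun j : Fin t => B j)
    (fun i j hij => hB.disj i i.2 j j.2 (fun h => hij (Fin.ext h)))
    (Finset.univ.filter fun p => p.1 < p.2) (by simp) (fun i => hB.conn i i.2) ?_ ?_
  · intro p hp
    exact hm.trans (hB.pair p.1 p.2 (Finset.mem_filter.1 hp).2 p.2.2)
  · intro i j hij h
    simp [hij] at h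

end Blobs

/-! ### Choice of parameters -/

-- Take s ≈ 2 sqrt(n/ε), m ≈ εs/4 and D = s - m. Then sm ≥ s²ε/4 ≥ n and ts ≤ εn/2. The damage bound
-- rests on (1 - ε/4)(1 - ε/2) > 1 - ε, with slack to absorb the rounding.
set_option maxHeartbeats 800000 in
theorem exists_blob_parameters {n t q : ℕ} {ε a : ℝ} (ha : 4 ≤ a) (han : a ^ 4 = n)
    (hεa : 4 ≤ ε * a) (hq0 : 0 < q) (ht : (t : ℝ) ≤ ε ^ 2 * a ^ 2 / 5)
    (hq : (q : ℝ) ≤ (1 - ε) * n) :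
    ∃ s m D : ℕ, 0 < s ∧ m + D ≤ s ∧ q + 1 + t * s ≤ n ∧
      (s - 1) * (q + 1) < D * (n - t * s) ∧ q + 1 ≤ s * m := by
  have hn0 : (0 : ℝ) < n := by rw [← han]; positivity
  have hε0 : 0 < ε := by
    by_contra! h
    nlinarith
  have hε1 : ε < 1 := by
    by_contra! h
    have : (0 : ℝ) < q := by exact_mod_cast hq0
    nlinarith
  -- Working with w = sqrt ε and R = sqrt n makes all estimates rational in `w` and `R`.
  obtain ⟨w, hw0, rfl⟩ : ∃ w : ℝ, 0 < w ∧ ε = w ^ 2 :=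
    ⟨√ε, Real.sqrt_pos.2 hε0, (Real.sq_sqrt hε0.le).symm⟩
  have hw1 : w < 1 := by
    by_contra! h
    nlinarith
  set R := a ^ 2 with hR
  have hR16 : 16 ≤ R := by nlinarith
  have hnR : (n : ℝ) = R ^ 2 := by rw [← han, hR]; ring
  have hεn : 256 ≤ w ^ 2 * n := by
    rw [← han]
    have h3 : 64 ≤ a ^ 3 := by nlinarith
    nlinarith
  have hRw : 16 ≤ R * w := by
    rw [hnR] at hεn
    have h0 : 0 < R * w := by positivity
    nlinarith
  set x := 2 * R / w with hx
  have hxw : x * w = 2 * R := by rw [hx]; field_simp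
  have hx0 : 0 < x := by positivity
  set s := ⌈x⌉₊
  have hs1 : x ≤ s := Nat.le_ceil x
  have hs2 : (s : ℝ) < x + 1 := Nat.ceil_lt_add_one hx0.le
  have hs0 : (0 : ℝ) < s := hx0.trans_le hs1
  set m := ⌈(s : ℝ) * w ^ 2 / 4⌉₊
  have hm1 : (s : ℝ) * w ^ 2 / 4 ≤ m := Nat.le_ceil _
  have hm2 : (m : ℝ) < s * w ^ 2 / 4 + 1 := Nat.ceil_lt_add_one (by positivity)
  have hsw : 32 ≤ s * w ^ 2 := by
    calc (32 : ℝ) ≤ x * w * w := by rw [hxw]; linarith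
      _ = x * w ^ 2 := by ring
      _ ≤ _ := by gcongr
  have hw2 : w ^ 2 < 1 := hε1
  have hs32 : (32 : ℝ) ≤ s := by nlinarith
  have hms : m ≤ s := by
    have : (m : ℝ) ≤ s := by nlinarith
    exact_mod_cast this
  have hts : (t : ℝ) * s ≤ w ^ 2 * n / 2 := by
    calc (t : ℝ) * s ≤ ((w ^ 2) ^ 2 * R / 5) * (x + 1) := by gcongr
      _ = (w ^ 3 * R * (x * w) + w ^ 4 * R) / 5 := by ring
      _ = w ^ 2 * (2 * w * R ^ 2 + w ^ 2 * R) / 5 := by rw [hxw]; ring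
      _ ≤ w ^ 2 * (2 * 1 * R ^ 2 + 1 * R) / 5 := by gcongr
      _ ≤ w ^ 2 * n / 2 := by
        rw [hnR]
        have : 0 < w ^ 2 := by positivity
        have h5 : 2 * 1 * R ^ 2 + 1 * R ≤ 5 / 2 * R ^ 2 := by nlinarith
        nlinarith
  have hqts : q + 1 + t * s ≤ n := by
    have : (q : ℝ) + 1 + t * s ≤ n := by linarith
    exact_mod_cast this
  refine ⟨s, m, s - m, by exact_mod_cast hs0, by omega, hqts, ?_, ?_⟩
  · have h1 : (s : ℝ) * (q + 1) < (s - m) * (n - t * s) := by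
      have hD : (s : ℝ) - s * w ^ 2 / 4 - 1 ≤ s - m := by linarith
      have hD0 : 0 ≤ (s : ℝ) - s * w ^ 2 / 4 - 1 := by nlinarith
      have hN : (n : ℝ) * (1 - w ^ 2 / 2) ≤ n - t * s := by linarith
      have hN0 : 0 ≤ (n : ℝ) * (1 - w ^ 2 / 2) := mul_nonneg hn0.le (by linarith)
      have h2 : 32 * (n : ℝ) ≤ s * w ^ 2 * n := by gcongr
      have h3 : 256 * (s : ℝ) ≤ w ^ 2 * n * s := by gcongr
      have h4 : 0 ≤ (s : ℝ) * n * (w ^ 2) ^ 2 := by positivity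
      have h5 : 0 ≤ w ^ 2 * (n : ℝ) := by positivity
      calc (s : ℝ) * (q + 1) ≤ s * ((1 - w ^ 2) * n + 1) := by gcongr
        _ < (s - s * w ^ 2 / 4 - 1) * (n * (1 - w ^ 2 / 2)) := by
            -- The gain s w² n/4 outweighs the loss n + s: `h2` and `h3` each bound one of the two
            -- terms.
            have h6 : (s - s * w ^ 2 / 4 - 1) * (n * (1 - w ^ 2 / 2)) =
                s * ((1 - w ^ 2) * n + 1) + s * w ^ 2 * n / 4 + s * n * (w ^ 2) ^ 2 / 8
                  + w ^ 2 * n / 2 - n - s := by ring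
            rw [h6]
            linarith
        _ ≤ _ := mul_le_mul hD hN hN0 (hD0.trans hD)
    have h2 : s * (q + 1) < (s - m) * (n - t * s) := by
      have h3 : t * s ≤ n := by omega
      have : ((s * (q + 1) : ℕ) : ℝ) < (((s - m) * (n - t * s) : ℕ) : ℝ) := by
        push_cast [hms, h3]
        exact h1
      exact_mod_cast this
    exact (Nat.mul_le_mul_right _ (Nat.sub_le _ _)).trans_lt h2
  · have : (n : ℝ) ≤ s * m := by
      calc (n : ℝ) = (x * w) * (x * w) / 4 := by rw [hxw, hnR]; ring
        _ = x * (x * w ^ 2 / 4) := by ring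
        _ ≤ s * (s * w ^ 2 / 4) := by gcongr
        _ ≤ _ := by gcongr
    have h' : n ≤ s * m := by exact_mod_cast this
    omega

theorem waiter_forces_minor {n t q : ℕ} {ε : ℝ} (hn : 256 ≤ n) (hq0 : 0 < q)
    (hε : 4 * (n : ℝ) ^ (-(1 / 4) : ℝ) ≤ ε) (ht : (t : ℝ) ≤ ε ^ 2 * Real.sqrt (n : ℝ) / 5)
    (hq : (q : ℝ) ≤ (1 - ε) * (n : ℝ)) :
    WaiterCanForce (edgesK n) q (HasCompleteMinor t) := by
  have hn0 : (0 : ℝ) ≤ n := Nat.cast_nonneg n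
  set a : ℝ := (n : ℝ) ^ (1 / 4 : ℝ) with ha
  have han : a ^ 4 = n := by
    rw [ha, ← Real.rpow_natCast, ← Real.rpow_mul hn0]
    norm_num
  have ha0 : 0 ≤ a := by positivity
  have ha4 : 4 ≤ a := by
    have h256 : (4 : ℝ) ^ 4 ≤ a ^ 4 := by
      rw [han]
      norm_num
      exact_mod_cast hn
    exact le_of_pow_le_pow_left₀ (by norm_num) ha0 h256
  have hsqrt : √(n : ℝ) = a ^ 2 := by
    rw [← han, show a ^ 4 = (a ^ 2) ^ 2 by ring, Real.sqrt_sq (by positivity)]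
  rw [Real.rpow_neg hn0, ← ha] at hε
  have hεa : 4 ≤ ε * a := by
    have := mul_le_mul_of_nonneg_right hε ha0
    rwa [mul_assoc, inv_mul_cancel₀ (by linarith), mul_one] at this
  rw [hsqrt] at ht
  obtain ⟨s, m, D, h1, h2, h3, h4, h5⟩ := exists_blob_parameters ha4 han hεa hq0 ht hq
  exact waiterCanForce_minor h1 h2 h3 h4 h5

end WaiterClient

theorem theorem1p1 :
    ∃ n₀ : ℕ, ∀ n : ℕ, n₀ ≤ n →
      (∀ (ε : ℝ) (t q : ℕ), 0 < q →
        4 * (n : ℝ) ^ (-(1 / 4) : ℝ) ≤ ε →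
        (t : ℝ) ≤ ε ^ 2 * Real.sqrt (n : ℝ) / 5 →
        (q : ℝ) ≤ (1 - ε) * (n : ℝ) →
        WaiterClient.WaiterCanForce (WaiterClient.edgesK n) q
          (fun E => WaiterClient.HasCompleteMinor t E)) ∧
      (∀ (η : ℝ) (q : ℕ),
        (n : ℝ) ^ (2 / 3 : ℝ) * Real.log (n : ℝ) ≤ η →
        (n : ℝ) + η ≤ (q : ℝ) →
        WaiterClient.ClientCanMaintain (WaiterClient.edgesK n) q
          (fun E => ¬ WaiterClient.HasCompleteMinor 4 E)) :=
  -- 256 = 4⁴ gives n^(1/4) ≥ 4 for Waiter; Client's part needs only 27.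
  ⟨256, fun _ hn => ⟨fun _ _ _ hq0 hε ht hq => WaiterClient.waiter_forces_minor hn hq0 hε ht hq,
    fun _ _ hη hq => WaiterClient.client_maintains_no_K4_minor (by omega) hη hq⟩⟩
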